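/- For a group $G$ and $g\in G$, let $R_g$ be the right multiplication operator on the Hilbert space $\ell^2(G)$, $R_g(\delta_h)=\delta_{hg}$ for $h \in G$. For an operator $A$ on $\ell^2(G)$ that is a finite complex linear combination of operators $R_g$, let $A_\perp\colon (\ker A)^\perp\to\ell^2(G)$ be the restriction of $A$ to the orthogonal complement of its kernel. The (classical) Fuglede--Kadison determinant of $A$ over $G$ is $$\det{}_G(A)=\lim_{\varepsilon\to 0^+}\exp\Big(\tfrac12\,\mathrm{tr}_G\big(\ln(A_\perp^*A_\perp+\varepsilon\,\mathrm{Id})\big)\Big),$$ where $\ln$ is taken in the sense of functional calculus and $\mathrm{tr}_G$ is the von Neumann trace: if $T$ is an operator on a closed subspace $K\subseteq \ell^2(G)$ with orthogonal projection $p\colon \ell^2(G)\to K$, then $\mathrm{tr}_G(T)=\langle T p\,\delta_1,\delta_1\rangle$. **Theorem.** Let $d\ge 3$, let $x_1,\dots,x_{d-1}$ be $d-1$ elements that generate the free group $\mathbb F_{d-1}$ of rank $d-1$ (equivalently, free generators of $\mathbb F_{d-1}$), and let $\zeta_1,\dots,\zeta_{d-1}\in\mathbb C$ with $|\zeta_1|=\dots=|\zeta_{d-1}|=1$.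 Then $$\det{}_{\mathbb F_{d-1}}\big(\mathrm{Id}+\zeta_1R_{x_1}+\dots+\zeta_{d-1}R_{x_{d-1}}\big)=\frac{(d-1)^{\frac{d-1}{2}}}{d^{\frac{d-2}{2}}}.$$ In particular, for any two generators $x,y$ of the free group $\mathbb F_2$, $$\det{}_{\mathbb F_2}(\mathrm{Id}+R_x+R_y)=\frac{2}{\sqrt3}.$$ -/

import Mathlib

open scoped Topology InnerProductSpace

noncomputable section

namespace FugledeKadison

/-- The Hilbert space `ℓ²(G)` of square-summable complex functions on `G`. -/
abbrev L2 (G : Type*) := lp (fun _ : G => ℂ) 2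

/-- The operator `ln (B^* B + ε Id)` on the Hilbert space `H`, with the real logarithm in the sense
of the functional calculus of self-adjoint operators. For `ε > 0` the spectrum of `B^* B + ε Id`
is contained in `[ε, ∞)`. -/
def logAdjointMulSelfAdd {H H' : Type*}
    [NormedAddCommGroup H] [InnerProductSpace ℂ H] [CompleteSpace H]
    [NormedAddCommGroup H'] [InnerProductSpace ℂ H'] [CompleteSpace H']
    (B : H →L[ℂ] H') (ε : ℝ) : H →L[ℂ] H :=
  CFC.log (ContinuousLinearMap.adjoint B ∘L B + (ε : ℂ) • ContinuousLinearMap.id ℂ H)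

section Group

variable {G : Type*} [Group G]

/-- Translating a square-summable function by a group element on the right keeps it
square-summable. -/
theorem memℓp_translate (g : G) (f : L2 G) :
    Memℓp (E := fun _ : G => ℂ) (fun h => f (h * g⁻¹)) 2 := by
  have hp : 0 < (2 : ENNReal).toReal := by norm_num
  exact memℓp_gen (((lp.memℓp f).summable hp).comp_injective (mul_left_injective g⁻¹))

/-- Right multiplication by `g`, as a linear isometry of `ℓ²(G)`:
`(f g)(h) = f (h g⁻¹)`, so that the basis vector `δ_h` is sent to `δ_{hg}`. -/
def rightMulIsometry (g : G) : L2 G →ₗᵢ[ℂ] L2 G where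
  toFun f := ⟨fun h => f (h * g⁻¹), memℓp_translate g f⟩
  map_add' _ _ := rfl
  map_smul' _ _ := rfl
  norm_map' f := by
    have hp : 0 < (2 : ENNReal).toReal := by norm_num
    rw [lp.norm_eq_tsum_rpow hp, lp.norm_eq_tsum_rpow hp]
    congr 1
    exact (Equiv.mulRight g⁻¹).tsum_eq (fun h => ‖f h‖ ^ (2 : ENNReal).toReal)

/-- The right multiplication operator `R_g ∈ B(ℓ²(G))`. -/
def R (g : G) : L2 G →L[ℂ] L2 G := (rightMulIsometry g).toContinuousLinearMap

open scoped Classical in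
/-- The basis vector `δ_1 ∈ ℓ²(G)` at the neutral element of `G`. -/
def deltaOne (G : Type*) [Group G] : L2 G := lp.single 2 (1 : G) (1 : ℂ)

/-- The von Neumann trace of an operator `T` on a closed subspace `K` of `ℓ²(G)`. With `p` the
orthogonal projection of `ℓ²(G)` onto `K`, it is `⟨δ_1, T p δ_1⟩`, where `T p` takes values in
`K ⊆ ℓ²(G)`. For `K = ℓ²(G)` and `T = a₀ Id + a₁ R_{g₁} + … + a_r R_{g_r}` with the `g_i ≠ 1`, it
is the coefficient `a₀`. -/
def vnTrace (K : Submodule ℂ (L2 G)) [K.HasOrthogonalProjection] (T : K →L[ℂ] K) : ℂ :=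
  ⟪deltaOne G, (T (K.orthogonalProjectionOnto (deltaOne G)) : L2 G)⟫_ℂ

/-- The restriction `A_⊥` of `A` to the orthogonal complement of its kernel. -/
def restrictPerp (A : L2 G →L[ℂ] L2 G) : (LinearMap.ker A.toLinearMap)ᗮ →L[ℂ] L2 G :=
  A ∘L (LinearMap.ker A.toLinearMap)ᗮ.subtypeL

/-- The quantity `exp (½ tr_G (ln (A_⊥^* A_⊥ + ε Id)))`. The trace of the self-adjoint
logarithm is real. -/
def regularizedDet (A : L2 G →L[ℂ] L2 G) (ε : ℝ) : ℝ :=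
  Real.exp ((1 / 2) * (vnTrace (LinearMap.ker A.toLinearMap)ᗮ
    (logAdjointMulSelfAdd (restrictPerp A) ε)).re)

/-- The Fuglede–Kadison determinant of `A`: the limit of `regularizedDet A ε` as `ε → 0⁺`. -/
def fkDet (A : L2 G →L[ℂ] L2 G) : ℝ :=
  Filter.limUnder (𝓝[>] (0 : ℝ)) (regularizedDet A)

end Group

end FugledeKadison

end

/-! ### Functional calculus bounds for `log (B^* B + ε)` -/

namespace FugledeKadison

section Operator

variable {H : Type*} [NormedAddCommGroup H] [InnerProductSpace ℂ H] [CompleteSpace H]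

/-! Put `ν = d - 1`. A generating family of `ν` elements is a basis, because free groups of finite
rank are Hopfian. So `A` is the biadjacency operator of the `(ν + 1)`-regular tree, twisted by the
unitary character `χ` that takes the values `ζ i` on the basis.

On the tree the resolvent is explicit. A radial function `(-s) ^ dist` has one closer and `ν`
farther neighbours at every vertex except the base point, so after the twist it solves `(A^* A + ε)
f = c δ₁` with `ε = (1 - ν s)² / s`. The value at the base point gives `tr (A^* A + ε)⁻¹ = s / ((1 -
ν s)(1 + s))`; see `exists_resolvent_apply_deltaOne`.

The function `F ε = tr log (A^* A + ε)` has this trace as its derivative and behaves like `log ε` at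
infinity. Integrating gives `F = -log s - (ν - 1) log (1 + s)` (`eq_neg_log_of_supergradient`). As
`ε → 0⁺` the parameter `s` tends to `ν⁻¹`, and `exp (F / 2)` tends to the stated value. The
restriction to `(ker A)ᗮ` changes nothing: `ε tr (A^* A + ε)⁻¹ → 0` forces `δ₁ ⊥ ker A`. -/

lemma log_add_smul_id_eq_cfc {T : H →L[ℂ] H} (hT : 0 ≤ T) {ε : ℝ} (hε : 0 < ε) :
    CFC.log (T + (ε : ℂ) • ContinuousLinearMap.id ℂ H) =
      cfc (fun t : ℝ => Real.log (t + ε)) T := by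
  have hsa : IsSelfAdjoint T := IsSelfAdjoint.of_nonneg hT
  have hadd : T + (ε : ℂ) • ContinuousLinearMap.id ℂ H = cfc (fun t : ℝ => t + ε) T := by
    rw [cfc_add_const ε (fun t => t) T, cfc_id' ℝ T, Algebra.algebraMap_eq_smul_one]
    rfl
  have hcont : ContinuousOn Real.log ((fun t : ℝ => t + ε) '' spectrum ℝ T) := by
    refine Real.continuousOn_log.mono ?_
    rintro _ ⟨t, ht, rfl⟩
    have := spectrum_nonneg_of_nonneg hT ht
    exact ne_of_gt (by positivity)
  rw [hadd, CFC.log, ← cfc_comp' Real.log (fun t : ℝ => t + ε) T hcont]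

lemma re_inner_cfc_le {T : H →L[ℂ] H} (hT : 0 ≤ T) {f g : ℝ → ℝ} (u : H)
    (hfg : ∀ t, 0 ≤ t → f t ≤ g t) (hf : ContinuousOn f (spectrum ℝ T))
    (hg : ContinuousOn g (spectrum ℝ T)) :
    (⟪u, cfc f T u⟫_ℂ).re ≤ (⟪u, cfc g T u⟫_ℂ).re := by
  have h : cfc f T ≤ cfc g T :=
    cfc_mono (fun t ht => hfg t (spectrum_nonneg_of_nonneg hT ht)) hf hg
  have h2 := ((ContinuousLinearMap.le_def _ _).1 h).re_inner_nonneg_right u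
  simp only [sub_apply, inner_sub_right] at h2
  simpa using h2

lemma continuousOn_log_add {T : H →L[ℂ] H} (hT : 0 ≤ T) {ε : ℝ} (hε : 0 < ε) :
    ContinuousOn (fun t : ℝ => Real.log (t + ε)) (spectrum ℝ T) := by
  refine ContinuousOn.log (by fun_prop) fun t ht => ?_
  have := spectrum_nonneg_of_nonneg hT ht
  positivity

lemma continuousOn_inv_add {T : H →L[ℂ] H} (hT : 0 ≤ T) {ε : ℝ} (hε : 0 < ε) :
    ContinuousOn (fun t : ℝ => (t + ε)⁻¹) (spectrum ℝ T) := by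
  refine ContinuousOn.inv₀ (by fun_prop) fun t ht => ?_
  have := spectrum_nonneg_of_nonneg hT ht
  positivity

/-- Since `T + ε` is invertible, any solution of the resolvent equation is the value of the
resolvent. An explicitly guessed `f` is therefore enough. -/
lemma cfc_inv_add_apply {T : H →L[ℂ] H} (hT : 0 ≤ T) {ε : ℝ} (hε : 0 < ε) {u f : H}
    (hf : T f + (ε : ℂ) • f = u) : cfc (fun t : ℝ => (t + ε)⁻¹) T u = f := by
  have hsa : IsSelfAdjoint T := IsSelfAdjoint.of_nonneg hT
  have hadd : T + (ε : ℂ) • ContinuousLinearMap.id ℂ H = cfc (fun t : ℝ => t + ε) T := by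
    rw [cfc_add_const ε (fun t => t) T, cfc_id' ℝ T, Algebra.algebraMap_eq_smul_one]
    rfl
  have hmul : cfc (fun t : ℝ => (t + ε)⁻¹) T * cfc (fun t : ℝ => t + ε) T = 1 := by
    rw [← cfc_mul _ _ T (continuousOn_inv_add hT hε) (by fun_prop), ← cfc_one ℝ T]
    refine cfc_congr fun t ht => ?_
    have := spectrum_nonneg_of_nonneg hT ht
    exact inv_mul_cancel₀ (by positivity)
  have : u = cfc (fun t : ℝ => t + ε) T f := by rw [← hadd, ← hf]; rfl
  rw [this, ← mul_apply_eq_comp, hmul]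
  rfl

variable {H' : Type*} [NormedAddCommGroup H'] [InnerProductSpace ℂ H'] [CompleteSpace H']
  (B : H →L[ℂ] H')

lemma adjoint_comp_self_nonneg : 0 ≤ ContinuousLinearMap.adjoint B ∘L B := by
  rw [ContinuousLinearMap.nonneg_iff_isPositive]
  exact ContinuousLinearMap.isPositive_adjoint_comp_self B

/-- `ε ↦ ⟨u, log (B^* B + ε) u⟩` is concave, with the resolvent `⟨u, (B^* B + a)⁻¹ u⟩` as a
supergradient at `a`. -/
lemma re_inner_log_sub_le {a b : ℝ} (ha : 0 < a) (hb : 0 < b) {u f : H}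
    (hf : (ContinuousLinearMap.adjoint B ∘L B) f + (a : ℂ) • f = u) :
    (⟪u, logAdjointMulSelfAdd B b u⟫_ℂ).re - (⟪u, logAdjointMulSelfAdd B a u⟫_ℂ).re
      ≤ (b - a) * (⟪u, f⟫_ℂ).re := by
  have hT := adjoint_comp_self_nonneg B
  simp only [logAdjointMulSelfAdd]
  rw [log_add_smul_id_eq_cfc hT ha, log_add_smul_id_eq_cfc hT hb]
  set T := ContinuousLinearMap.adjoint B ∘L B
  have hsa : IsSelfAdjoint T := IsSelfAdjoint.of_nonneg hT
  have hla := continuousOn_log_add hT ha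
  have hlb := continuousOn_log_add hT hb
  have hi := continuousOn_inv_add hT ha
  -- The tangent line of `log` at `t + a` lies above its graph.
  have key := re_inner_cfc_le hT (f := fun t => Real.log (t + b))
    (g := fun t => Real.log (t + a) + (b - a) * (t + a)⁻¹) u (fun t ht => ?_) hlb
    (hla.add (continuousOn_const.mul hi))
  · rw [cfc_add T _ (fun t => (b - a) * (t + a)⁻¹) hla (continuousOn_const.mul hi), cfc_const_mul _ _ T hi] at key
    simp only [add_apply, inner_add_right, smul_apply,
      cfc_inv_add_apply hT ha hf] at key
    rw [← Complex.coe_smul, inner_smul_right, Complex.add_re, Complex.re_ofReal_mul] at key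
    linarith
  · have h1 : 0 < t + a := by positivity
    have h2 : 0 < t + b := by positivity
    have h3 := Real.log_le_sub_one_of_pos (div_pos h2 h1)
    rw [Real.log_div h2.ne' h1.ne'] at h3
    have h4 : (t + b) / (t + a) - 1 = (b - a) * (t + a)⁻¹ := by field_simp; ring
    linarith

/-- Together with `re_inner_log_le`, this fixes the constant of integration: the logarithm differs
from `log a` by `O(1 / a)`. -/
lemma le_re_inner_log {a : ℝ} (ha : 0 < a) {u : H} (hu : ‖u‖ = 1) :
    Real.log a ≤ (⟪u, logAdjointMulSelfAdd B a u⟫_ℂ).re := by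
  have hT := adjoint_comp_self_nonneg B
  simp only [logAdjointMulSelfAdd]
  rw [log_add_smul_id_eq_cfc hT ha]
  set T := ContinuousLinearMap.adjoint B ∘L B
  have hsa : IsSelfAdjoint T := IsSelfAdjoint.of_nonneg hT
  have key := re_inner_cfc_le hT (f := fun _ => Real.log a) u
    (fun t ht => Real.log_le_log ha (by linarith)) continuousOn_const (continuousOn_log_add hT ha)
  rw [cfc_const _ T, Algebra.algebraMap_eq_smul_one] at key
  simp only [smul_apply, one_apply_eq_self] at key
  rw [← Complex.coe_smul, inner_smul_right, Complex.re_ofReal_mul,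
    inner_self_eq_norm_sq_to_K, hu] at key
  simpa using key

lemma re_inner_log_le {a : ℝ} (ha : 0 < a) {u : H} (hu : ‖u‖ = 1) :
    (⟪u, logAdjointMulSelfAdd B a u⟫_ℂ).re ≤ Real.log a + ‖B u‖ ^ 2 / a := by
  have hT := adjoint_comp_self_nonneg B
  have hB : (⟪u, (ContinuousLinearMap.adjoint B ∘L B) u⟫_ℂ).re = ‖B u‖ ^ 2 := by
    rw [ContinuousLinearMap.comp_apply, ContinuousLinearMap.adjoint_inner_right,
      inner_self_eq_norm_sq_to_K]
    norm_cast
  simp only [logAdjointMulSelfAdd]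
  rw [log_add_smul_id_eq_cfc hT ha, ← hB]
  set T := ContinuousLinearMap.adjoint B ∘L B
  have hsa : IsSelfAdjoint T := IsSelfAdjoint.of_nonneg hT
  have key := re_inner_cfc_le hT (g := fun t => Real.log a + a⁻¹ * t) u
    (fun t ht => ?_) (continuousOn_log_add hT ha) (by fun_prop)
  · rw [cfc_const_add _ _ T, cfc_const_mul_id _ T, Algebra.algebraMap_eq_smul_one] at key
    simp only [smul_apply, one_apply_eq_self,
      add_apply, inner_add_right] at key
    rw [← Complex.coe_smul, ← Complex.coe_smul, inner_smul_right, inner_smul_right, Complex.add_re,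
      Complex.re_ofReal_mul, Complex.re_ofReal_mul, inner_self_eq_norm_sq_to_K, hu] at key
    simp only [div_eq_inv_mul]
    simpa using key
  · have h2 : 0 < t + a := by positivity
    have h3 := Real.log_le_sub_one_of_pos (div_pos h2 ha)
    rw [Real.log_div h2.ne' ha.ne'] at h3
    have h4 : (t + a) / a - 1 = a⁻¹ * t := by field_simp; ring
    linarith

end Operator

end FugledeKadison

/-! ### Recovering a function from its supergradient -/

namespace FugledeKadison

open Filter Set

/-- A function with a supergradient given, in the parametrisation `ε = (1 - νs)² / s`, by
`s / ((1 - νs)(1 + s))`, and asymptotic to `log` at infinity, is determined. -/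
lemma eq_neg_log_of_supergradient {ν : ℝ} (hν : 0 < ν) {F : ℝ → ℝ} {C : ℝ}
    (hF : ∀ s ∈ Ioo 0 ν⁻¹, ∀ b, 0 < b →
      F b - F ((1 - ν * s) ^ 2 / s) ≤
        (b - (1 - ν * s) ^ 2 / s) * (s / ((1 - ν * s) * (1 + s))))
    (hlow : ∀ a, 0 < a → Real.log a ≤ F a) (hup : ∀ a, 0 < a → F a ≤ Real.log a + C / a)
    {s : ℝ} (hs : s ∈ Ioo 0 ν⁻¹) :
    F ((1 - ν * s) ^ 2 / s) = -Real.log s - (ν - 1) * Real.log (1 + s) := by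
  have hpos : ∀ s ∈ Ioo 0 ν⁻¹, 0 < s ∧ 0 < 1 - ν * s := fun s hs => by
    refine ⟨hs.1, ?_⟩
    have := mul_lt_mul_of_pos_left hs.2 hν
    rw [mul_inv_cancel₀ hν.ne'] at this
    linarith
  set e : ℝ → ℝ := fun s => (1 - ν * s) ^ 2 / s with he
  set G : ℝ → ℝ := fun s => s / ((1 - ν * s) * (1 + s)) with hG
  have hepos : ∀ s ∈ Ioo 0 ν⁻¹, 0 < e s := fun s hs => by
    obtain ⟨h1, h2⟩ := hpos s hs
    simp only [he]; positivity
  have hed : ∀ s ∈ Ioo 0 ν⁻¹, HasDerivAt e (-((1 - ν * s) * (1 + ν * s)) / s ^ 2) s := by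
    intro s hs
    obtain ⟨h1, h2⟩ := hpos s hs
    have h3 : HasDerivAt (fun s : ℝ => (1 - ν * s) ^ 2) (2 * (1 - ν * s) * (-ν)) s := by
      have := (((hasDerivAt_id s).const_mul ν).const_sub 1).pow 2
      refine this.congr_deriv ?_
      simp
    refine (h3.div (hasDerivAt_id s) h1.ne').congr_deriv ?_
    simp only [id]
    congr 1
    ring
  have hGc : ∀ s ∈ Ioo 0 ν⁻¹, ContinuousAt G s := by
    intro s hs
    obtain ⟨h1, h2⟩ := hpos s hs
    exact continuousAt_id.div (by fun_prop) (by positivity)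
  have hFd : ∀ s ∈ Ioo 0 ν⁻¹, HasDerivAt (fun s => F (e s))
      ((-((1 - ν * s) * (1 + ν * s)) / s ^ 2) * G s) s := by
    intro s hs
    have hlin := (hed s hs).isBigO_sub
    have hGo : (fun x => G x - G s) =o[𝓝 s] (fun _ => (1 : ℝ)) := by
      rw [Asymptotics.isLittleO_one_iff]
      simpa using (hGc s hs).tendsto.sub_const (G s)
    have hprod := hlin.mul_isLittleO hGo
    -- The supergradient inequalities at `s` and at `x` bound the error between `0` and `(e x - e s)
    -- * (G x - G s)` up to sign, which is `o(x - s)` by continuity of `G`.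
    have hmain : (fun x => F (e x) - F (e s) - (e x - e s) * G s) =o[𝓝 s] fun x => x - s := by
      refine Asymptotics.IsLittleO.trans_isBigO (Asymptotics.IsBigO.trans_isLittleO
        (Asymptotics.IsBigO.of_bound 1 ?_) hprod) (by simpa using Asymptotics.isBigO_refl _ _)
      filter_upwards [Ioo_mem_nhds hs.1 hs.2] with x hx
      have h1 := hF s hs (e x) (hepos x hx)
      have h2 := hF x hx (e s) (hepos s hs)
      rw [one_mul, Real.norm_eq_abs, Real.norm_eq_abs, abs_le]
      have h3 := neg_abs_le ((e x - e s) * (G x - G s))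
      have h4 := abs_nonneg ((e x - e s) * (G x - G s))
      change F (e x) - F (e s) ≤ (e x - e s) * G s at h1
      change F (e s) - F (e x) ≤ (e s - e x) * G x at h2
      constructor <;> nlinarith
    have hlin2 := (hasDerivAt_iff_isLittleO.1 (hed s hs)).const_mul_left (G s)
    rw [hasDerivAt_iff_isLittleO]
    refine (hmain.add hlin2).congr_left fun x => ?_
    simp only [smul_eq_mul]
    ring
  -- Partial fractions: `e' G = -(1 + ν s) / (s (1 + s)) = -1 / s - (ν - 1) / (1 + s)`, so `D` has
  -- derivative zero.
  set D : ℝ → ℝ := fun s => F (e s) + Real.log s + (ν - 1) * Real.log (1 + s) with hD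
  have hDd : ∀ s ∈ Ioo 0 ν⁻¹, HasDerivAt D 0 s := by
    intro s hs
    obtain ⟨h1, h2⟩ := hpos s hs
    have h3 : HasDerivAt (fun s : ℝ => Real.log (1 + s)) (1 / (1 + s)) s :=
      ((hasDerivAt_id s).const_add 1).log (by simp only [id]; positivity)
    refine (((hFd s hs).add (Real.hasDerivAt_log h1.ne')).add
      (h3.const_mul (ν - 1))).congr_deriv ?_
    simp only [hG]
    have : 1 - ν * s ≠ 0 := h2.ne'
    have : 1 + s ≠ 0 := by positivity
    field_simp
    ring
  have hconst : ∀ x ∈ Ioo 0 ν⁻¹, D x = D s := fun x hx =>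
    (isOpen_Ioo.is_const_of_deriv_eq_zero isPreconnected_Ioo
      (fun y hy => (hDd y hy).differentiableAt.differentiableWithinAt)
      (fun y hy => (hDd y hy).deriv)) hx hs
  have hmem : Ioo 0 ν⁻¹ ∈ 𝓝[>] (0 : ℝ) := Ioo_mem_nhdsGT (by positivity)
  -- As `s → 0⁺`, `e s → ∞`, and in `log (e s) + log s = 2 log (1 - ν s)` the singular terms cancel.
  have hlim : Tendsto D (𝓝[>] 0) (𝓝 0) := by
    have hc : Tendsto (fun s : ℝ => 2 * Real.log (1 - ν * s) + (ν - 1) * Real.log (1 + s))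
        (𝓝[>] 0) (𝓝 0) := by
      have : ContinuousAt
          (fun s : ℝ => 2 * Real.log (1 - ν * s) + (ν - 1) * Real.log (1 + s)) 0 := by
        refine ContinuousAt.add (continuousAt_const.mul (ContinuousAt.log (by fun_prop) ?_))
          (continuousAt_const.mul (ContinuousAt.log (by fun_prop) ?_)) <;> simp
      simpa using this.tendsto.mono_left nhdsWithin_le_nhds
    have hc2 : Tendsto (fun s : ℝ => C * (s / (1 - ν * s) ^ 2)) (𝓝[>] 0) (𝓝 0) := by
      have : ContinuousAt (fun s : ℝ => C * (s / (1 - ν * s) ^ 2)) 0 :=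
        continuousAt_const.mul (continuousAt_id.div (by fun_prop) (by simp))
      simpa using this.tendsto.mono_left nhdsWithin_le_nhds
    have hc3 := hc.add hc2
    rw [add_zero] at hc3
    have hlog : ∀ s ∈ Ioo 0 ν⁻¹, Real.log (e s) = 2 * Real.log (1 - ν * s) - Real.log s := by
      intro s hs
      obtain ⟨h1, h2⟩ := hpos s hs
      simp only [he]
      rw [Real.log_div (by positivity) h1.ne', Real.log_pow]
      norm_num
    refine tendsto_of_tendsto_of_tendsto_of_le_of_le' hc hc3 ?_ ?_
    · filter_upwards [hmem] with x hx
      have h1 := hlow (e x) (hepos x hx)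
      rw [hlog x hx] at h1
      simp only [hD]
      linarith
    · filter_upwards [hmem] with x hx
      have h1 := hup (e x) (hepos x hx)
      have h2 : C / e x = C * (x / (1 - ν * x) ^ 2) := by
        simp only [he, div_div_eq_mul_div, mul_div_assoc]
      rw [hlog x hx, h2] at h1
      simp only [hD]
      linarith
  have hDs : D s = 0 := by
    refine tendsto_nhds_unique (tendsto_const_nhds.congr' ?_) hlim
    filter_upwards [hmem] with x hx using (hconst x hx).symm
  simp only [hD] at hDs
  linarith

end FugledeKadison

/-! ### Residual finiteness and the Hopf property -/

namespace FreeGroup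

/-- A partial injection of a finite type, given as a relation, extends to a permutation. -/
lemma exists_perm_of_rel {β : Type*} [Finite β] (ρ : β → β → Prop)
    (hfun : ∀ a b b', ρ a b → ρ a b' → b = b') (hinj : ∀ a a' b, ρ a b → ρ a' b → a = a') :
    ∃ σ : Equiv.Perm β, ∀ a b, ρ a b → σ a = b := by
  classical
  have := Fintype.ofFinite β
  let p : β → Prop := fun a => ∃ b, ρ a b
  let q : β → Prop := fun b => ∃ a, ρ a b
  let e : {a // p a} ≃ {b // q b} := Equiv.ofBijective
    (fun a => ⟨a.2.choose, a.1, a.2.choose_spec⟩) (by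
      constructor
      · intro a a' h
        have h' : a.2.choose = a'.2.choose := congrArg Subtype.val h
        exact Subtype.ext (hinj _ _ _ a.2.choose_spec (h' ▸ a'.2.choose_spec))
      · rintro ⟨b, a, hab⟩
        have ha : p a := ⟨b, hab⟩
        exact ⟨⟨a, ha⟩, Subtype.ext (hfun _ _ _ ha.choose_spec hab)⟩)
  refine ⟨e.extendSubtype, fun a b hab => ?_⟩
  have ha : p a := ⟨b, hab⟩
  rw [e.extendSubtype_apply_of_mem a ha]
  exact hfun _ _ _ ha.choose_spec hab

/-- Every nontrivial element of a free group acts nontrivially on some finite set. -/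
lemma exists_perm_hom_ne_one {α : Type*} {w : FreeGroup α} (hw : w ≠ 1) :
    ∃ (m : ℕ) (f : FreeGroup α →* Equiv.Perm (Fin m)), f w ≠ 1 := by
  classical
  set L := w.toWord with hL
  have hred : IsReduced L := isReduced_toWord
  -- The points are the `L.length + 1` gaps between letters. The letter at index `k`, sign included,
  -- has to move gap `k + 1` to gap `k`.
  let ρ : α → Fin (L.length + 1) → Fin (L.length + 1) → Prop := fun i a b =>
    (L[(b : ℕ)]? = some (i, true) ∧ (a : ℕ) = b + 1) ∨
      (L[(a : ℕ)]? = some (i, false) ∧ (b : ℕ) = a + 1)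
  -- Reducedness makes each `ρ i` a partial injection: a clash would require two adjacent cancelling
  -- letters.
  have hno : ∀ (i : α) (b : Bool) (k : ℕ), L[k]? = some (i, b) → L[k + 1]? ≠ some (i, !b) := by
    intro i b k h1 h2
    have h3 := List.isChain_iff_getElem.1 hred k
    rw [List.getElem?_eq_some_iff] at h1 h2
    obtain ⟨h1, h1'⟩ := h1
    obtain ⟨h2, h2'⟩ := h2
    have h4 := h3 h2
    rw [h1', h2'] at h4
    simp at h4
  have hσ : ∀ i, ∃ σ : Equiv.Perm (Fin (L.length + 1)), ∀ a b, ρ i a b → σ a = b := by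
    intro i
    refine exists_perm_of_rel (ρ i) ?_ ?_
    · rintro a b b' (⟨h1, h2⟩ | ⟨h1, h2⟩) (⟨h3, h4⟩ | ⟨h3, h4⟩)
      · exact Fin.ext (by omega)
      · rw [h2] at h3
        exact absurd h3 (hno i true _ h1)
      · rw [h4] at h1
        exact absurd h1 (hno i true _ h3)
      · exact Fin.ext (by omega)
    · rintro a a' b (⟨h1, h2⟩ | ⟨h1, h2⟩) (⟨h3, h4⟩ | ⟨h3, h4⟩)
      · exact Fin.ext (by omega)
      · rw [h4] at h1
        exact absurd h1 (hno i false _ h3)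
      · rw [h2] at h3
        exact absurd h3 (hno i false _ h1)
      · exact Fin.ext (by omega)
  choose σ hσ using hσ
  -- Letters act from the right end, so a suffix carries the last gap to the gap where it begins.
  -- The whole word then carries the last gap to `0`.
  have key : ∀ L₂ L₁ : List (α × Bool), L = L₁ ++ L₂ →
      ∀ (h : L₁.length < L.length + 1),
        lift σ (mk L₂) (Fin.last L.length) = ⟨L₁.length, h⟩ := by
    intro L₂
    induction L₂ with
    | nil =>
      intro L₁ h1 h
      ext
      simp [h1, ← one_eq_mk]
    | cons x L₂ ih =>
      intro L₁ h1 h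
      have h2 : L = (L₁ ++ [x]) ++ L₂ := by simp [h1]
      have h3 : (L₁ ++ [x]).length < L.length + 1 := by rw [h2]; simp
      have h4 : mk (x :: L₂) = mk [x] * mk L₂ := by simp [mul_mk]
      have h5 : L[L₁.length]? = some x := by simp [h1]
      rw [h4, _root_.map_mul, Equiv.Perm.mul_apply, ih _ h2 h3]
      obtain ⟨i, b⟩ := x
      cases b
      · have h6 : lift σ (mk [(i, false)]) = (σ i)⁻¹ := by simp [lift_mk]
        rw [h6, Equiv.Perm.inv_eq_iff_eq, eq_comm]
        exact hσ i _ _ (Or.inr ⟨h5, by simp⟩)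
      · have h6 : lift σ (mk [(i, true)]) = σ i := by simp [lift_mk]
        rw [h6]
        exact hσ i _ _ (Or.inl ⟨h5, by simp⟩)
  refine ⟨L.length + 1, lift σ, fun h => hw ?_⟩
  have h1 := key L [] rfl (by simp)
  rw [show mk L = w from mk_toWord, h, Equiv.Perm.one_apply] at h1
  have h2 : L.length = 0 := congrArg Fin.val h1
  exact toWord_eq_nil_iff.1 (List.length_eq_zero_iff.1 h2)

/-- Free groups of finite rank are Hopfian. -/
lemma injective_of_surjective {α : Type*} [Finite α] {φ : FreeGroup α →* FreeGroup α}
    (hφ : Function.Surjective φ) : Function.Injective φ := by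
  rw [injective_iff_map_eq_one]
  intro w hw
  by_contra hne
  obtain ⟨m, f, hf⟩ := exists_perm_hom_ne_one hne
  have : Finite (FreeGroup α →* Equiv.Perm (Fin m)) := Finite.of_equiv _ lift
  -- Malcev's argument: precomposition with `φ` is injective on a finite set of homomorphisms, hence
  -- surjective. So `f` factors through `φ` and kills `w`.
  have hinj : Function.Injective
      (fun g : FreeGroup α →* Equiv.Perm (Fin m) => g.comp φ) :=
    fun g g' h => (MonoidHom.cancel_right hφ).1 h
  obtain ⟨g, rfl⟩ := Finite.injective_iff_surjective.1 hinj f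
  exact hf (by simp [hw])

/-- A generating family of a free group indexed by a basis is the image of that basis under an
automorphism. -/
lemma exists_mulEquiv_of_closure_eq_top {α : Type*} [Finite α] {x : α → FreeGroup α}
    (hx : Subgroup.closure (Set.range x) = ⊤) :
    ∃ φ : FreeGroup α ≃* FreeGroup α, ∀ i, φ (of i) = x i := by
  have hs : Function.Surjective (lift x) := by
    rw [← MonoidHom.range_eq_top, range_lift_eq_closure, hx]
  exact ⟨MulEquiv.ofBijective (lift x) ⟨injective_of_surjective hs, hs⟩,
    fun i => lift_apply_of⟩

end FreeGroup

/-! ### Distances and sphere sizes in the regular tree -/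

namespace FreeGroup

/-! The bipartite tree whose two vertex classes are copies of the free group on `α`, in which the
vertex `k` of the second class is joined to `k` and to all `of i * k` in the first class, is
regular of degree `card α + 1`. We compute distances to the vertex `1` of the first class. -/

/-- For a reduced word `w`, half the distance from the base point to the vertex `w` of the first
class, and half the distance rounded down to the vertex `w` of the second class. -/
def treeDistPair {α : Type*} : List (α × Bool) → ℕ × ℕ
  | [] => (0, 0)
  | (_, true) :: w => ((treeDistPair w).2 + 1, (treeDistPair w).2 + 1)
  | (_, false) :: w => ((treeDistPair w).1 + 1, (treeDistPair w).1)

variable {α : Type*} [DecidableEq α]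

/-- Half the distance from the base point to the vertex `k` of the first class. -/
def distFst (k : FreeGroup α) : ℕ := (treeDistPair k.toWord).1

/-- Half the distance, rounded down, from the base point to the vertex `k` of the second class. -/
def distSnd (k : FreeGroup α) : ℕ := (treeDistPair k.toWord).2

/-- The neutral element together with the basis. -/
def ofOption : Option α → FreeGroup α
  | none => 1
  | some i => of i

lemma toWord_mk_singleton_mul (a : α × Bool) (k : FreeGroup α) :
    (mk [a] * k).toWord =
      List.casesOn k.toWord [a] fun hd tl =>
        if a.1 = hd.1 ∧ a.2 = not hd.2 then tl else a :: hd :: tl := by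
  rw [toWord_mul, toWord_mk, reduce_singleton, List.singleton_append, reduce.cons, reduce_toWord]

lemma toWord_of_mul (i : α) (k : FreeGroup α) :
    (of i * k).toWord =
      List.casesOn k.toWord [(i, true)] fun hd tl =>
        if i = hd.1 ∧ true = not hd.2 then tl else (i, true) :: hd :: tl :=
  toWord_mk_singleton_mul (i, true) k

lemma toWord_of_inv_mul (i : α) (k : FreeGroup α) :
    ((of i)⁻¹ * k).toWord =
      List.casesOn k.toWord [(i, false)] fun hd tl =>
        if i = hd.1 ∧ false = not hd.2 then tl else (i, false) :: hd :: tl := by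
  have : (of i)⁻¹ = mk [(i, false)] := by simp [of, inv_mk, invRev]
  rw [this]
  exact toWord_mk_singleton_mul (i, false) k

lemma distFst_eq_zero {k : FreeGroup α} : distFst k = 0 ↔ k = 1 := by
  rw [← toWord_eq_nil_iff, distFst]
  rcases k.toWord with _ | ⟨⟨j, _ | _⟩, w⟩ <;> simp [treeDistPair]

/-- Exactly one neighbour of a vertex of the second class is closer to the base point. -/
lemma exists_distFst_ofOption_mul (k : FreeGroup α) :
    ∃ o, distFst (ofOption o * k) = distSnd k ∧
      ∀ o', o' ≠ o → distFst (ofOption o' * k) = distSnd k + 1 := by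
  -- The closer neighbour cancels the first letter when that letter is an inverse generator.
  -- Otherwise it is `k` itself, viewed in the first class.
  rcases h : k.toWord with _ | ⟨⟨j, _ | _⟩, w⟩
  · refine ⟨none, ?_, ?_⟩
    · simp [ofOption, distFst, distSnd, h, treeDistPair]
    · rintro (_ | i) hi
      · exact absurd rfl hi
      · simp [ofOption, distFst, distSnd, toWord_of_mul, h, treeDistPair]
  · refine ⟨some j, ?_, ?_⟩
    · simp [ofOption, distFst, distSnd, toWord_of_mul, h, treeDistPair]
    · rintro (_ | i) hi
      · simp [ofOption, distFst, distSnd, h, treeDistPair]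
      · have : i ≠ j := fun e => hi (by rw [e])
        simp [ofOption, distFst, distSnd, toWord_of_mul, h, treeDistPair, this]
  · refine ⟨none, ?_, ?_⟩
    · simp [ofOption, distFst, distSnd, h, treeDistPair]
    · rintro (_ | i) hi
      · exact absurd rfl hi
      · simp [ofOption, distFst, distSnd, toWord_of_mul, h, treeDistPair]

/-- Exactly one neighbour of a vertex of the first class other than the base point is closer to
the base point. -/
lemma exists_distSnd_ofOption_inv_mul {k : FreeGroup α} (hk : k ≠ 1) :
    ∃ o, distSnd ((ofOption o)⁻¹ * k) + 1 = distFst k ∧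
      ∀ o', o' ≠ o → distSnd ((ofOption o')⁻¹ * k) = distFst k := by
  rcases h : k.toWord with _ | ⟨⟨j, _ | _⟩, w⟩
  · exact absurd (toWord_eq_nil_iff.1 h) hk
  · refine ⟨none, ?_, ?_⟩
    · simp [ofOption, distFst, distSnd, h, treeDistPair]
    · rintro (_ | i) hi
      · exact absurd rfl hi
      · simp [ofOption, distFst, distSnd, toWord_of_inv_mul, h, treeDistPair]
  · refine ⟨some j, ?_, ?_⟩
    · simp [ofOption, distFst, distSnd, toWord_of_inv_mul, h, treeDistPair]
    · rintro (_ | i) hi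
      · simp [ofOption, distFst, distSnd, h, treeDistPair]
      · have : i ≠ j := fun e => hi (by rw [e])
        simp [ofOption, distFst, distSnd, toWord_of_inv_mul, h, treeDistPair, this]

lemma distSnd_ofOption_inv_mul_one (o : Option α) :
    distSnd ((ofOption o)⁻¹ * (1 : FreeGroup α)) = 0 := by
  rcases o with _ | i
  · simp [ofOption, distSnd, treeDistPair]
  · simp [distSnd, ofOption, toWord_of_inv_mul, treeDistPair, -mul_one]

open scoped ENNReal

/-- The number of vertices of the first class at distance `2 * m` from the base point. -/
noncomputable def countFst (α : Type*) [DecidableEq α] (m : ℕ) : ℝ≥0∞ :=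
  ∑' k : FreeGroup α, if distFst k = m then 1 else 0

/-- The number of vertices of the second class at distance `2 * m + 1` from the base point. -/
noncomputable def countSnd (α : Type*) [DecidableEq α] (m : ℕ) : ℝ≥0∞ :=
  ∑' k : FreeGroup α, if distSnd k = m then 1 else 0

lemma countFst_zero : countFst α 0 = 1 := by
  simp [countFst, distFst_eq_zero]

variable [Fintype α] {M : Type*} [AddCommMonoid M]

lemma sum_eq_of_unique_option {h : Option α → M} {a b : M}
    (H : ∃ o, h o = a ∧ ∀ o', o' ≠ o → h o' = b) :
    ∑ o, h o = a + Fintype.card α • b := by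
  obtain ⟨o, h1, h2⟩ := H
  rw [← Finset.add_sum_erase _ _ (Finset.mem_univ o), h1,
    Finset.sum_congr rfl (fun o' ho' => h2 o' (Finset.ne_of_mem_erase ho')), Finset.sum_const,
    Finset.card_erase_of_mem (Finset.mem_univ o), Finset.card_univ, Fintype.card_option,
    Nat.add_sub_cancel]

lemma sum_distFst_ofOption_mul (k : FreeGroup α) (h : ℕ → M) :
    ∑ o, h (distFst (ofOption o * k)) =
      h (distSnd k) + Fintype.card α • h (distSnd k + 1) := by
  obtain ⟨o, h1, h2⟩ := exists_distFst_ofOption_mul k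
  exact sum_eq_of_unique_option ⟨o, by rw [h1], fun o' ho' => by rw [h2 o' ho']⟩

lemma sum_distSnd_ofOption_inv_mul {k : FreeGroup α} {l : ℕ} (hk : distFst k = l + 1)
    (h : ℕ → M) :
    ∑ o, h (distSnd ((ofOption o)⁻¹ * k)) = h l + Fintype.card α • h (l + 1) := by
  have hk1 : k ≠ 1 := fun e => by rw [distFst_eq_zero.2 e] at hk; omega
  obtain ⟨o, h1, h2⟩ := exists_distSnd_ofOption_inv_mul hk1
  exact sum_eq_of_unique_option
    ⟨o, by rw [show distSnd ((ofOption o)⁻¹ * k) = l by omega],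
      fun o' ho' => by rw [h2 o' ho', hk]⟩

lemma sum_distSnd_ofOption_inv_mul_one (h : ℕ → M) :
    ∑ o, h (distSnd ((ofOption o)⁻¹ * (1 : FreeGroup α))) = (Fintype.card α + 1) • h 0 := by
  simp only [distSnd_ofOption_inv_mul_one, Finset.sum_const, Finset.card_univ,
    Fintype.card_option]

/-- Double counting of the edges between two spheres, once from each vertex class. -/
lemma tsum_edges (a b : ℕ) :
    (∑' k : FreeGroup α, (if distFst k = a then (1 : ℝ≥0∞) else 0) *
        ∑ o, if distSnd ((ofOption o)⁻¹ * k) = b then 1 else 0) =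
      ∑' k : FreeGroup α, (if distSnd k = b then (1 : ℝ≥0∞) else 0) *
        ∑ o, if distFst (ofOption o * k) = a then 1 else 0 := by
  simp only [Finset.mul_sum]
  rw [Summable.tsum_finsetSum fun _ _ => ENNReal.summable,
    Summable.tsum_finsetSum fun _ _ => ENNReal.summable]
  refine Finset.sum_congr rfl fun o _ => ?_
  rw [← (Equiv.mulLeft (ofOption o)).tsum_eq]
  refine tsum_congr fun k => ?_
  rw [Equiv.coe_mulLeft, inv_mul_cancel_left, mul_comm]

/-- Each vertex of the outer sphere has exactly one neighbour in the inner one, and each vertex of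
the inner sphere has `card α` neighbours in the outer one. -/
lemma countFst_succ (m : ℕ) : countFst α (m + 1) = Fintype.card α * countSnd α m := by
  have h := tsum_edges (α := α) (m + 1) m
  have h1 : ∀ k : FreeGroup α, (if distFst k = m + 1 then (1 : ℝ≥0∞) else 0) *
      (∑ o, if distSnd ((ofOption o)⁻¹ * k) = m then 1 else 0) =
        if distFst k = m + 1 then 1 else 0 := by
    intro k
    split_ifs with hk
    · rw [sum_distSnd_ofOption_inv_mul hk (fun l => if l = m then (1 : ℝ≥0∞) else 0)]
      simp
    · simp
  have h2 : ∀ k : FreeGroup α, (if distSnd k = m then (1 : ℝ≥0∞) else 0) *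
      (∑ o, if distFst (ofOption o * k) = m + 1 then 1 else 0) =
        Fintype.card α * if distSnd k = m then 1 else 0 := by
    intro k
    split_ifs with hk
    · rw [sum_distFst_ofOption_mul k (fun l => if l = m + 1 then (1 : ℝ≥0∞) else 0)]
      simp [hk]
    · simp
  rw [tsum_congr h1, tsum_congr h2, ENNReal.tsum_mul_left] at h
  exact h

lemma countSnd_zero : countSnd α 0 = Fintype.card α + 1 := by
  have h := tsum_edges (α := α) 0 0
  have h1 : ∀ k : FreeGroup α, (if distFst k = 0 then (1 : ℝ≥0∞) else 0) *
      (∑ o, if distSnd ((ofOption o)⁻¹ * k) = 0 then 1 else 0) =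
        (Fintype.card α + 1) * if distFst k = 0 then 1 else 0 := by
    intro k
    split_ifs with hk
    · rw [distFst_eq_zero] at hk
      subst hk
      rw [sum_distSnd_ofOption_inv_mul_one (fun l => if l = 0 then (1 : ℝ≥0∞) else 0)]
      simp
    · simp
  have h2 : ∀ k : FreeGroup α, (if distSnd k = 0 then (1 : ℝ≥0∞) else 0) *
      (∑ o, if distFst (ofOption o * k) = 0 then 1 else 0) =
        if distSnd k = 0 then 1 else 0 := by
    intro k
    split_ifs with hk
    · rw [sum_distFst_ofOption_mul k (fun l => if l = 0 then (1 : ℝ≥0∞) else 0)]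
      simp [hk]
    · simp
  rw [tsum_congr h1, tsum_congr h2, ENNReal.tsum_mul_left] at h
  change _ * countFst α 0 = countSnd α 0 at h
  rw [← h, countFst_zero, mul_one]

lemma countSnd_succ (m : ℕ) : countSnd α (m + 1) = Fintype.card α * countFst α (m + 1) := by
  have h := tsum_edges (α := α) (m + 1) (m + 1)
  have h1 : ∀ k : FreeGroup α, (if distFst k = m + 1 then (1 : ℝ≥0∞) else 0) *
      (∑ o, if distSnd ((ofOption o)⁻¹ * k) = m + 1 then 1 else 0) =
        Fintype.card α * if distFst k = m + 1 then 1 else 0 := by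
    intro k
    split_ifs with hk
    · rw [sum_distSnd_ofOption_inv_mul hk (fun l => if l = m + 1 then (1 : ℝ≥0∞) else 0)]
      simp
    · simp
  have h2 : ∀ k : FreeGroup α, (if distSnd k = m + 1 then (1 : ℝ≥0∞) else 0) *
      (∑ o, if distFst (ofOption o * k) = m + 1 then 1 else 0) =
        if distSnd k = m + 1 then 1 else 0 := by
    intro k
    split_ifs with hk
    · rw [sum_distFst_ofOption_mul k (fun l => if l = m + 1 then (1 : ℝ≥0∞) else 0)]
      simp [hk]
    · simp
  rw [tsum_congr h1, tsum_congr h2, ENNReal.tsum_mul_left] at h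
  exact h.symm

lemma countFst_succ_eq (m : ℕ) : countFst α (m + 1) =
    (Fintype.card α + 1) * Fintype.card α * ((Fintype.card α : ℝ≥0∞) ^ 2) ^ m := by
  induction m with
  | zero => rw [countFst_succ, countSnd_zero, pow_zero, mul_one, mul_comm]
  | succ m ih => rw [countFst_succ, countSnd_succ, ih]; ring

/-- Spheres in the first class grow like `(card α) ^ (2 * m)`, so grouping by distance leaves a
convergent geometric series. -/
lemma summable_pow_distFst {t : ℝ} (ht : 0 ≤ t) (ht1 : (Fintype.card α : ℝ) ^ 2 * t < 1) :
    Summable fun k : FreeGroup α => t ^ distFst k := by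
  set T : ℝ≥0∞ := ENNReal.ofReal t with hT
  have hTtop : T ≠ ∞ := ENNReal.ofReal_ne_top
  have hr : (Fintype.card α : ℝ≥0∞) ^ 2 * T < 1 := by
    rw [← ENNReal.ofReal_natCast, ← ENNReal.ofReal_pow (by positivity), hT,
      ← ENNReal.ofReal_mul (by positivity), ← ENNReal.ofReal_one]
    exact (ENNReal.ofReal_lt_ofReal_iff one_pos).2 ht1
  have hfib : ∑' k : FreeGroup α, T ^ distFst k = ∑' m, countFst α m * T ^ m := by
    simp only [countFst, ← ENNReal.tsum_mul_right]
    rw [ENNReal.tsum_comm]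
    refine tsum_congr fun k => ?_
    rw [tsum_eq_single (distFst k) (fun m hm => by simp [hm.symm])]
    simp
  have hfin : ∑' k : FreeGroup α, T ^ distFst k ≠ ∞ := by
    rw [hfib, tsum_eq_zero_add' ENNReal.summable, countFst_zero]
    have : ∀ m, countFst α (m + 1) * T ^ (m + 1) =
        ((Fintype.card α + 1) * Fintype.card α * T) * ((Fintype.card α : ℝ≥0∞) ^ 2 * T) ^ m := by
      intro m
      rw [countFst_succ_eq, mul_pow]
      ring
    simp only [this, ENNReal.tsum_mul_left, ENNReal.tsum_geometric]
    refine ENNReal.add_ne_top.2 ⟨by simp, ENNReal.mul_ne_top ?_ ?_⟩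
    · exact ENNReal.mul_ne_top (by finiteness) hTtop
    · exact ENNReal.inv_ne_top.2 (tsub_pos_of_lt hr).ne'
  have := ENNReal.summable_toReal hfin
  refine this.congr fun k => ?_
  rw [ENNReal.toReal_pow, hT, ENNReal.toReal_ofReal ht]

end FreeGroup

/-! ### The explicit resolvent at `δ₁` -/

namespace FugledeKadison

open Set

section Group

variable {G : Type*} [Group G]

lemma R_apply (g : G) (f : L2 G) (h : G) : R g f h = f (h * g⁻¹) := rfl

lemma inner_deltaOne_left (f : L2 G) : ⟪deltaOne G, f⟫_ℂ = f 1 := by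
  classical
  rw [deltaOne, lp.inner_single_left]
  simp

lemma norm_deltaOne : ‖deltaOne G‖ = 1 := by
  classical
  rw [deltaOne, lp.norm_single (by norm_num)]
  simp

lemma deltaOne_apply_one : deltaOne G 1 = 1 := by
  classical
  rw [deltaOne, lp.single_apply_self]

lemma deltaOne_apply_of_ne {g : G} (hg : g ≠ 1) : deltaOne G g = 0 := by
  classical
  rw [deltaOne, lp.single_apply_ne _ _ _ hg]

lemma adjoint_R (g : G) : ContinuousLinearMap.adjoint (R g) = R g⁻¹ := by
  symm
  rw [ContinuousLinearMap.eq_adjoint_iff]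
  intro f f'
  rw [lp.inner_eq_tsum, lp.inner_eq_tsum, ← (Equiv.mulRight g⁻¹).tsum_eq]
  refine tsum_congr fun h => ?_
  simp [R_apply]

lemma sum_smul_R_apply {ι : Type*} [Fintype ι] (c : ι → ℂ) (x : ι → G) (f : L2 G) (h : G) :
    (∑ i, c i • R (x i)) f h = ∑ i, c i * f (h * (x i)⁻¹) := by
  rw [sum_apply, lp.coeFn_sum]
  exact Finset.sum_apply h Finset.univ fun i => ((c i • R (x i)) f : G → ℂ)

/-- Let `A = 1 + ∑ i, ζ i • R (x i)` with free generators `x i` and unimodular `ζ i`. A radial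
function on a regular tree, twisted by a character, solves `(A^* A + ε) f = δ₁`. -/
lemma exists_resolvent_apply_deltaOne {α : Type*} [Fintype α] (φ : FreeGroup α ≃* G)
    {ζ : α → ℂ} (hζ : ∀ i, ‖ζ i‖ = 1) {s : ℝ} (hs : 0 < s) (hs1 : Fintype.card α * s < 1) :
    let A : L2 G →L[ℂ] L2 G :=
      ContinuousLinearMap.id ℂ _ + ∑ i, ζ i • R (φ (FreeGroup.of i))
    ∃ f : L2 G, (ContinuousLinearMap.adjoint A ∘L A) f +
        (((1 - Fintype.card α * s) ^ 2 / s : ℝ) : ℂ) • f = deltaOne G ∧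
      ⟪deltaOne G, f⟫_ℂ = ((s / ((1 - Fintype.card α * s) * (1 + s)) : ℝ) : ℂ) := by
  classical
  intro A
  set ν : ℝ := ((Fintype.card α : ℕ) : ℝ) with hν
  have hν1 : 0 < 1 - ν * s := by linarith
  let ζ₀ : α → Circle := fun i => ⟨ζ i, by simpa [Submonoid.unitSphere] using hζ i⟩
  let χ : FreeGroup α →* Circle := FreeGroup.lift ζ₀
  have hχ : ∀ i, (χ (FreeGroup.of i) : ℂ) = ζ i := fun i =>
    congrArg Subtype.val (FreeGroup.lift_apply_of (f := ζ₀) (x := i))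
  -- Inversion turns the right translations in `A` into the left multiplications that define the
  -- tree.
  let v : G → FreeGroup α := fun g => (φ.symm g)⁻¹
  have hv : ∀ g k, v (g * φ k) = k⁻¹ * v g := fun g k => by simp [v]
  have hv' : ∀ g k, v (g * (φ k)⁻¹) = k * v g := fun g k => by simp [v]
  let ζ' : Option α → ℂ := fun o => χ (FreeGroup.ofOption o)
  have hζ' : ∀ o, ‖ζ' o‖ = 1 := fun o => Circle.norm_coe _
  have hA : ∀ (f : L2 G) g,
      A f g = ∑ o, ζ' o * f (g * (φ (FreeGroup.ofOption o))⁻¹) := by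
    intro f g
    rw [Fintype.sum_option]
    simp only [A, add_apply, lp.coeFn_add, Pi.add_apply, sum_smul_R_apply]
    simp [ζ', FreeGroup.ofOption, hχ]
  have hA' : ∀ (f : L2 G) g, ContinuousLinearMap.adjoint A f g =
      ∑ o, (starRingEnd ℂ) (ζ' o) * f (g * φ (FreeGroup.ofOption o)) := by
    intro f g
    rw [Fintype.sum_option]
    simp only [A, map_add, map_sum, ContinuousLinearMap.adjoint_id, map_smulₛₗ, adjoint_R,
      add_apply, lp.coeFn_add, Pi.add_apply, sum_smul_R_apply]
    simp [ζ', FreeGroup.ofOption, hχ]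
  have hmem : Memℓp (E := fun _ : G => ℂ)
      (fun g => (((χ (v g) : Circle) : ℂ))⁻¹ * ((-s : ℝ) : ℂ) ^ (FreeGroup.distFst (v g))) 2 := by
    refine memℓp_gen ?_
    -- Here `t = s ^ 2`, because square-summability is needed. The condition `ν ^ 2 * s ^ 2 < 1` is
    -- `ν * s < 1` squared.
    have h1 := FreeGroup.summable_pow_distFst (α := α) (t := s ^ 2) (by positivity) (by
      rw [← mul_pow]
      exact pow_lt_one₀ (by positivity) hs1 two_ne_zero)
    have h2 := (φ.symm.toEquiv.trans (Equiv.inv _)).summable_iff.2 h1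
    refine h2.congr fun g => ?_
    simp only [norm_mul, norm_inv, Circle.norm_coe, norm_pow, Complex.norm_real, norm_neg]
    simp [v, ← pow_mul, mul_comm, abs_of_pos hs]
  let f : L2 G := ⟨_, hmem⟩
  have hf : ∀ g, f g = (((χ (v g) : Circle) : ℂ))⁻¹ *
    ((-s : ℝ) : ℂ) ^ (FreeGroup.distFst (v g)) := fun g => rfl
  have hAf : ∀ g, A f g = (((χ (v g) : Circle) : ℂ))⁻¹ * (1 - ν * s) *
      ((-s : ℝ) : ℂ) ^ (FreeGroup.distSnd (v g)) := by
    intro g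
    have h1 : ∀ o, ζ' o * f (g * (φ (FreeGroup.ofOption o))⁻¹) = (((χ (v g) : Circle) : ℂ))⁻¹ *
        ((-s : ℝ) : ℂ) ^ (FreeGroup.distFst (FreeGroup.ofOption o * v g)) := by
      intro o
      rw [hf, hv', map_mul, Circle.coe_mul, mul_inv, ← mul_assoc, ← mul_assoc,
        mul_inv_cancel₀ (Circle.coe_ne_zero _), one_mul]
    rw [hA, Finset.sum_congr rfl fun o _ => h1 o, ← Finset.mul_sum,
      FreeGroup.sum_distFst_ofOption_mul _ fun l => ((-s : ℝ) : ℂ) ^ l, nsmul_eq_mul, hν]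
    push_cast
    ring
  have hAAf : ∀ g, ContinuousLinearMap.adjoint A (A f) g =
      (((χ (v g) : Circle) : ℂ))⁻¹ * (1 - ν * s) *
        ∑ o, ((-s : ℝ) : ℂ) ^ (FreeGroup.distSnd ((FreeGroup.ofOption o)⁻¹ * v g)) := by
    intro g
    rw [hA', Finset.mul_sum]
    refine Finset.sum_congr rfl fun o _ => ?_
    have h2 : (starRingEnd ℂ) (ζ' o) * ζ' o = 1 := by
      rw [← Complex.normSq_eq_conj_mul_self, Complex.normSq_eq_norm_sq, hζ']
      simp
    rw [hAf, hv, map_mul, map_inv, Circle.coe_mul, Circle.coe_inv, mul_inv, inv_inv]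
    change _ * (ζ' o * _ * _ * _) = _
    linear_combination ((((χ (v g) : Circle) : ℂ))⁻¹ * (1 - ν * s) *
      ((-s : ℝ) : ℂ) ^ (FreeGroup.distSnd ((FreeGroup.ofOption o)⁻¹ * v g))) * h2
  have hsC : (s : ℂ) ≠ 0 := by exact_mod_cast hs.ne'
  have hνC : (1 - ν * s : ℂ) ≠ 0 := by exact_mod_cast hν1.ne'
  have hνC' : (1 - s * ν : ℂ) ≠ 0 := by rwa [mul_comm]
  have hs1C : (1 + s : ℂ) ≠ 0 := by exact_mod_cast (by positivity : (1 + s) ≠ 0)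
  have hv1 : v 1 = 1 := by simp [v]
  -- The scalar normalises the value at the base point, where `(1 - ν s)(ν + 1) + (1 - ν s)² / s =
  -- (1 - ν s)(1 + s) / s`.
  refine ⟨((s / ((1 - ν * s) * (1 + s)) : ℝ) : ℂ) • f, ?_, ?_⟩
  · ext g
    have hval : ((ContinuousLinearMap.adjoint A ∘L A) (((s / ((1 - ν * s) * (1 + s)) : ℝ) : ℂ) • f) +
        (((1 - ν * s) ^ 2 / s : ℝ) : ℂ) • ((s / ((1 - ν * s) * (1 + s)) : ℝ) : ℂ) • f) g =
        ((s / ((1 - ν * s) * (1 + s)) : ℝ) : ℂ) * (ContinuousLinearMap.adjoint A (A f) g +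
          (((1 - ν * s) ^ 2 / s : ℝ) : ℂ) * f g) := by
      rw [map_smul, smul_comm, ← smul_add]
      rfl
    rw [hval, hAAf, hf]
    by_cases hg : g = 1
    · subst hg
      rw [hv1, FreeGroup.sum_distSnd_ofOption_inv_mul_one fun l => ((-s : ℝ) : ℂ) ^ l,
        FreeGroup.distFst_eq_zero.2 rfl, deltaOne_apply_one, nsmul_eq_mul]
      have hνc : ((Fintype.card α : ℕ) : ℂ) = (ν : ℂ) := by simp [hν]
      push_cast
      rw [hνc]
      simp only [map_one, Circle.coe_one]
      field_simp
      ring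
    -- Away from the base point `A^* A` contributes `(1 - ν s)² (-s) ^ l`, which `ε (-s) ^ (l + 1)`
    -- cancels. This dictates the choice of `ε`.
    · have hvg : v g ≠ 1 := fun h => hg (by simpa [v] using h)
      obtain ⟨l, hl⟩ := Nat.exists_eq_succ_of_ne_zero (mt FreeGroup.distFst_eq_zero.1 hvg)
      rw [FreeGroup.sum_distSnd_ofOption_inv_mul hl fun l => ((-s : ℝ) : ℂ) ^ l, hl,
        deltaOne_apply_of_ne hg, nsmul_eq_mul]
      have hνc : ((Fintype.card α : ℕ) : ℂ) = (ν : ℂ) := by simp [hν]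
      push_cast
      rw [hνc]
      field_simp
      ring
  · rw [inner_smul_right, inner_deltaOne_left, hf, hv1, FreeGroup.distFst_eq_zero.2 rfl]
    simp

end Group

end FugledeKadison

/-! ### Removing the kernel, and the limit `ε → 0⁺` -/

namespace FugledeKadison

open Set Filter

lemma sub_orthogonalProjectionOnto_mem_ker {G : Type*} (A : L2 G →L[ℂ] L2 G) (f : L2 G) :
    f - ((LinearMap.ker A.toLinearMap)ᗮ.orthogonalProjectionOnto f : L2 G) ∈
      LinearMap.ker A.toLinearMap := by
  have : IsClosed (LinearMap.ker A.toLinearMap : Set (L2 G)) := A.isClosed_ker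
  have : CompleteSpace (LinearMap.ker A.toLinearMap) := this.completeSpace_coe
  have h := (LinearMap.ker A.toLinearMap)ᗮ.sub_starProjection_mem_orthogonal f
  rwa [Submodule.orthogonal_orthogonal] at h

/-- A solution of the resolvent equation of `A^* A` projects to a solution of that of
`A_⊥^* A_⊥`. -/
lemma restrictPerp_resolvent {G : Type*} {A : L2 G →L[ℂ] L2 G} {u f : L2 G} {ε : ℂ}
    (hf : (ContinuousLinearMap.adjoint A ∘L A) f + ε • f = u) :
    (ContinuousLinearMap.adjoint (restrictPerp A) ∘L restrictPerp A)
        ((LinearMap.ker A.toLinearMap)ᗮ.orthogonalProjectionOnto f) +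
      ε • (LinearMap.ker A.toLinearMap)ᗮ.orthogonalProjectionOnto f =
      (LinearMap.ker A.toLinearMap)ᗮ.orthogonalProjectionOnto u := by
  have hAp : A ((LinearMap.ker A.toLinearMap)ᗮ.orthogonalProjectionOnto f : L2 G) = A f := by
    have h : A (f - _) = 0 := sub_orthogonalProjectionOnto_mem_ker A f
    rw [map_sub, sub_eq_zero] at h
    exact h.symm
  have hadj : ContinuousLinearMap.adjoint (restrictPerp A) =
      (LinearMap.ker A.toLinearMap)ᗮ.orthogonalProjectionOnto ∘L ContinuousLinearMap.adjoint A := by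
    rw [restrictPerp, ContinuousLinearMap.adjoint_comp, Submodule.adjoint_subtypeL]
  rw [hadj, ← hf, map_add, map_smul]
  simp only [ContinuousLinearMap.comp_apply]
  congr 3

section Group

variable {G : Type*} [Group G]

/-- If `ε ⟨δ₁, (A^* A + ε)⁻¹ δ₁⟩` takes arbitrarily small values then `δ₁ ⊥ ker A`. -/
lemma orthogonalProjectionOnto_deltaOne {A : L2 G →L[ℂ] L2 G}
    (hA : ∀ η : ℝ, 0 < η → ∃ (ε : ℝ) (f : L2 G), 0 < ε ∧
      (ContinuousLinearMap.adjoint A ∘L A) f + (ε : ℂ) • f = deltaOne G ∧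
      ε * (⟪deltaOne G, f⟫_ℂ).re < η) :
    ((LinearMap.ker A.toLinearMap)ᗮ.orthogonalProjectionOnto (deltaOne G) : L2 G)
      = deltaOne G := by
  set K := (LinearMap.ker A.toLinearMap)ᗮ with hK
  set δ := deltaOne G
  set q : L2 G := δ - (K.orthogonalProjectionOnto δ : L2 G) with hq
  have hAq : A q = 0 := sub_orthogonalProjectionOnto_mem_ker A δ
  have hqK : q ∈ Kᗮ := K.sub_starProjection_mem_orthogonal δ
  have hqδ : ⟪q, δ⟫_ℂ = (‖q‖ ^ 2 : ℝ) := by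
    have h1 : ⟪q, (K.orthogonalProjectionOnto δ : L2 G)⟫_ℂ = 0 :=
      (Submodule.mem_orthogonal' _ _).1 hqK _ (Subtype.property _)
    have h2 : δ = q + (K.orthogonalProjectionOnto δ : L2 G) := by rw [hq]; abel
    rw [h2, inner_add_right, h1, add_zero, inner_self_eq_norm_sq_to_K]
    norm_cast
  have hle : ∀ η : ℝ, 0 < η → ‖q‖ ^ 2 ≤ η := by
    intro η hη
    obtain ⟨ε, f, hε, hf, hlt⟩ := hA η hη
    -- Pairing the resolvent equation with `q ∈ ker A` removes the `A^* A` term.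
    have h1 : ‖q‖ ^ 2 ≤ ε * (‖q‖ * ‖f‖) := by
      have h2 : ((‖q‖ ^ 2 : ℝ) : ℂ) = ε * ⟪q, f⟫_ℂ := by
        rw [← hqδ, ← hf, inner_add_right, ContinuousLinearMap.comp_apply,
          ContinuousLinearMap.adjoint_inner_right, hAq, inner_zero_left, zero_add,
          inner_smul_right]
      have h3 := congrArg norm h2
      rw [Complex.norm_real, Real.norm_of_nonneg (by positivity), norm_mul, Complex.norm_real,
        Real.norm_of_nonneg hε.le] at h3
      rw [h3]
      gcongr
      exact norm_inner_le_norm q f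
    have h4 : ε * ‖f‖ ^ 2 ≤ (⟪δ, f⟫_ℂ).re := by
      have h5 : (⟪δ, f⟫_ℂ).re = ‖A f‖ ^ 2 + ε * ‖f‖ ^ 2 := by
        rw [← hf, inner_add_left, ContinuousLinearMap.comp_apply,
          ContinuousLinearMap.adjoint_inner_left, inner_smul_left, inner_self_eq_norm_sq_to_K,
          inner_self_eq_norm_sq_to_K]
        simp [← Complex.ofReal_pow]
      rw [h5]
      have := sq_nonneg ‖A f‖
      linarith
    have h6 : (ε * ‖f‖) ^ 2 < η := by
      refine lt_of_le_of_lt ?_ hlt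
      calc (ε * ‖f‖) ^ 2 = ε * (ε * ‖f‖ ^ 2) := by ring
        _ ≤ _ := by gcongr
    nlinarith [sq_nonneg (‖q‖ - ε * ‖f‖)]
  have hq0 : ‖q‖ ^ 2 ≤ 0 := le_of_forall_gt_imp_ge_of_dense fun η hη => hle η hη
  have hq1 : q = 0 := by
    rw [← norm_eq_zero]
    exact pow_eq_zero_iff two_ne_zero |>.1 (le_antisymm hq0 (by positivity))
  rw [hq, sub_eq_zero] at hq1
  exact hq1.symm

/-- The regularized determinant of an operator whose resolvent at `δ₁` is that of the adjacency
operator of the `(ν + 1)`-regular tree. -/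
lemma regularizedDet_eq {A : L2 G →L[ℂ] L2 G} {ν : ℝ} (hν : 0 < ν)
    (hA : ∀ s ∈ Ioo 0 ν⁻¹, ∃ f : L2 G, (ContinuousLinearMap.adjoint A ∘L A) f +
        (((1 - ν * s) ^ 2 / s : ℝ) : ℂ) • f = deltaOne G ∧
      ⟪deltaOne G, f⟫_ℂ = ((s / ((1 - ν * s) * (1 + s)) : ℝ) : ℂ))
    {s : ℝ} (hs : s ∈ Ioo 0 ν⁻¹) :
    regularizedDet A ((1 - ν * s) ^ 2 / s) =
      Real.exp ((1 / 2) * (-Real.log s - (ν - 1) * Real.log (1 + s))) := by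
  have hpos : ∀ s ∈ Ioo 0 ν⁻¹, 0 < s ∧ 0 < 1 - ν * s := fun s hs => by
    refine ⟨hs.1, ?_⟩
    have := mul_lt_mul_of_pos_left hs.2 hν
    rw [mul_inv_cancel₀ hν.ne'] at this
    linarith
  let K := (LinearMap.ker A.toLinearMap)ᗮ
  have hδ : (K.orthogonalProjectionOnto (deltaOne G) : L2 G) = deltaOne G := by
    refine orthogonalProjectionOnto_deltaOne fun η hη => ?_
    -- This function is `ε` times the trace of the resolvent.
    have hlim : Tendsto (fun s : ℝ => (1 - ν * s) / (1 + s)) (𝓝[<] ν⁻¹) (𝓝 0) := by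
      have : ContinuousAt (fun s : ℝ => (1 - ν * s) / (1 + s)) ν⁻¹ :=
        ContinuousAt.div (by fun_prop) (by fun_prop) (by positivity)
      have h := this.tendsto.mono_left (nhdsWithin_le_nhds (s := Iio ν⁻¹))
      simpa [hν.ne'] using h
    obtain ⟨t, ht1, ht2⟩ := ((hlim.eventually_lt_const hη).and
      (Ioo_mem_nhdsLT (inv_pos.2 hν))).exists
    obtain ⟨h1, h2⟩ := hpos t ht2
    obtain ⟨f, hf1, hf2⟩ := hA t ht2
    refine ⟨_, f, by positivity, hf1, ?_⟩
    rw [hf2, Complex.ofReal_re]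
    refine lt_of_eq_of_lt ?_ ht1
    field_simp
  let u : K := K.orthogonalProjectionOnto (deltaOne G)
  replace hδ : (u : L2 G) = deltaOne G := hδ
  have hu1 : ‖u‖ = 1 := by
    rw [Submodule.coe_norm, hδ, norm_deltaOne]
  set F : ℝ → ℝ := fun a => (⟪u, logAdjointMulSelfAdd (restrictPerp A) a u⟫_ℂ).re with hF
  have hreg : ∀ a, regularizedDet A a = Real.exp ((1 / 2) * F a) := by
    intro a
    simp only [regularizedDet, vnTrace, hF]
    rw [Submodule.coe_inner, hδ]
  rw [hreg, eq_neg_log_of_supergradient hν (F := F) (C := ‖restrictPerp A u‖ ^ 2) ?_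
    (fun a ha => le_re_inner_log _ ha hu1) (fun a ha => re_inner_log_le _ ha hu1) hs]
  intro t ht b hb
  obtain ⟨h1, h2⟩ := hpos t ht
  obtain ⟨f, hf1, hf2⟩ := hA t ht
  have h3 := re_inner_log_sub_le (restrictPerp A) (by positivity) hb (restrictPerp_resolvent hf1)
  have h4 : ⟪u, K.orthogonalProjectionOnto f⟫_ℂ = ⟪deltaOne G, f⟫_ℂ := by
    rw [Submodule.inner_orthogonalProjectionOnto_eq_of_mem_left, hδ]
  have h5 : (⟪u, K.orthogonalProjectionOnto f⟫_ℂ).re = t / ((1 - ν * t) * (1 + t)) := by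
    rw [h4, hf2, Complex.ofReal_re]
  rw [← h5]
  exact h3

lemma tendsto_regularizedDet {A : L2 G →L[ℂ] L2 G} {ν : ℝ} (hν : 0 < ν)
    (hA : ∀ s ∈ Ioo 0 ν⁻¹, ∃ f : L2 G, (ContinuousLinearMap.adjoint A ∘L A) f +
        (((1 - ν * s) ^ 2 / s : ℝ) : ℂ) • f = deltaOne G ∧
      ⟪deltaOne G, f⟫_ℂ = ((s / ((1 - ν * s) * (1 + s)) : ℝ) : ℂ)) :
    Tendsto (regularizedDet A) (𝓝[>] 0) (𝓝 (ν ^ (ν / 2) / (ν + 1) ^ ((ν - 1) / 2))) := by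
  -- The inverse of `s ↦ (1 - ν s)² / s`: the smaller root of `ν² s² - (2 ν + ε) s + 1 = 0`. The
  -- product of the roots is `ν⁻²`, so this is the one below `ν⁻¹`.
  set σ : ℝ → ℝ := fun ε => (2 * ν + ε - √(ε ^ 2 + 4 * ν * ε)) / (2 * ν ^ 2) with hσ
  have hσmem : ∀ ε, 0 < ε → σ ε ∈ Ioo 0 ν⁻¹ ∧ (1 - ν * σ ε) ^ 2 / σ ε = ε := by
    intro ε hε
    have hsq : √(ε ^ 2 + 4 * ν * ε) ^ 2 = ε ^ 2 + 4 * ν * ε := Real.sq_sqrt (by positivity)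
    have h1 : √(ε ^ 2 + 4 * ν * ε) < 2 * ν + ε := by
      rw [Real.sqrt_lt' (by positivity)]
      nlinarith [sq_pos_of_pos hν]
    have h2 : ε < √(ε ^ 2 + 4 * ν * ε) := by
      apply Real.lt_sqrt_of_sq_lt
      nlinarith [mul_pos hν hε]
    have h3 : 0 < σ ε := div_pos (by linarith) (by positivity)
    refine ⟨⟨h3, ?_⟩, ?_⟩
    · simp only [hσ]
      rw [div_lt_iff₀ (by positivity)]
      have : ν⁻¹ * (2 * ν ^ 2) = 2 * ν := by field_simp
      linarith
    · rw [div_eq_iff h3.ne']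
      simp only [hσ]
      set D := √(ε ^ 2 + 4 * ν * ε)
      field_simp
      linear_combination hsq
  have hσlim : Tendsto σ (𝓝[>] 0) (𝓝 ν⁻¹) := by
    have : Continuous σ := by fun_prop
    have h := (this.tendsto 0).mono_left (nhdsWithin_le_nhds (s := Ioi 0))
    have h0 : σ 0 = ν⁻¹ := by simp [hσ]; field_simp
    rwa [h0] at h
  have hcont : ContinuousAt
      (fun s : ℝ => Real.exp ((1 / 2) * (-Real.log s - (ν - 1) * Real.log (1 + s)))) ν⁻¹ := by
    have h1 : ν⁻¹ ≠ 0 := by positivity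
    have h2 : 1 + ν⁻¹ ≠ 0 := by positivity
    fun_prop (disch := assumption)
  have hval : Real.exp ((1 / 2) * (-Real.log ν⁻¹ - (ν - 1) * Real.log (1 + ν⁻¹))) =
      ν ^ (ν / 2) / (ν + 1) ^ ((ν - 1) / 2) := by
    have h1 : 1 + ν⁻¹ = (ν + 1) / ν := by field_simp
    rw [Real.rpow_def_of_pos hν, Real.rpow_def_of_pos (by positivity), ← Real.exp_sub, h1,
      Real.log_div (by positivity) hν.ne', Real.log_inv]
    congr 1
    ring
  have hlim := hcont.tendsto.comp hσlim
  rw [hval] at hlim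
  refine hlim.congr' ?_
  filter_upwards [self_mem_nhdsWithin] with ε hε
  obtain ⟨h1, h2⟩ := hσmem ε hε
  rw [Function.comp_apply, ← regularizedDet_eq hν hA h1, h2]

end Group

end FugledeKadison

/-! ### Arbitrary generators and the final statement -/

namespace FugledeKadison

open Set Filter

lemma tendsto_regularizedDet_of_closure_eq_top {n : ℕ} (hn : 0 < n)
    {x : Fin n → FreeGroup (Fin n)} (hx : Subgroup.closure (Set.range x) = ⊤)
    {ζ : Fin n → ℂ} (hζ : ∀ i, ‖ζ i‖ = 1) :
    Tendsto (regularizedDet (ContinuousLinearMap.id ℂ _ + ∑ i, ζ i • R (x i))) (𝓝[>] 0)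
      (𝓝 ((n : ℝ) ^ ((n : ℝ) / 2) / ((n : ℝ) + 1) ^ (((n : ℝ) - 1) / 2))) := by
  obtain ⟨φ, hφ⟩ := FreeGroup.exists_mulEquiv_of_closure_eq_top hx
  have hn' : (0 : ℝ) < n := by exact_mod_cast hn
  refine tendsto_regularizedDet hn' fun s hs => ?_
  have hs1 : n * s < 1 := by
    have := mul_lt_mul_of_pos_left hs.2 hn'
    rwa [mul_inv_cancel₀ hn'.ne'] at this
  have h := exists_resolvent_apply_deltaOne φ hζ hs.1 (by simpa using hs1)
  simpa only [hφ, Fintype.card_fin] using h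

end FugledeKadison

theorem theorem2p3 :
    (∀ (d : ℕ), 3 ≤ d →
      ∀ (x : Fin (d - 1) → FreeGroup (Fin (d - 1))),
        Subgroup.closure (Set.range x) = ⊤ →
      ∀ (ζ : Fin (d - 1) → ℂ), (∀ i, ‖ζ i‖ = 1) →
        Filter.Tendsto
            (FugledeKadison.regularizedDet
              (ContinuousLinearMap.id ℂ _ + ∑ i, ζ i • FugledeKadison.R (x i)))
            (nhdsWithin 0 (Set.Ioi 0))
            (nhds (((d : ℝ) - 1) ^ (((d : ℝ) - 1) / 2) / (d : ℝ) ^ (((d : ℝ) - 2) / 2))) ∧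
        FugledeKadison.fkDet (ContinuousLinearMap.id ℂ _ + ∑ i, ζ i • FugledeKadison.R (x i)) =
          ((d : ℝ) - 1) ^ (((d : ℝ) - 1) / 2) / (d : ℝ) ^ (((d : ℝ) - 2) / 2)) ∧
    (∀ x y : FreeGroup (Fin 2), Subgroup.closure {x, y} = ⊤ →
        Filter.Tendsto
            (FugledeKadison.regularizedDet
              (ContinuousLinearMap.id ℂ _ + FugledeKadison.R x + FugledeKadison.R y))
            (nhdsWithin 0 (Set.Ioi 0)) (nhds (2 / √3)) ∧
        FugledeKadison.fkDet
            (ContinuousLinearMap.id ℂ _ + FugledeKadison.R x + FugledeKadison.R y) =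
          2 / √3) := by
  constructor
  · intro d hd x hx ζ hζ
    have h := FugledeKadison.tendsto_regularizedDet_of_closure_eq_top (by omega) hx hζ
    have hd1 : ((d - 1 : ℕ) : ℝ) = (d : ℝ) - 1 := by
      rw [Nat.cast_sub (by omega), Nat.cast_one]
    rw [hd1, show (d : ℝ) - 1 + 1 = d by ring, show (d : ℝ) - 1 - 1 = d - 2 by ring] at h
    exact ⟨h, h.limUnder_eq⟩
  · intro x y hxy
    have h := FugledeKadison.tendsto_regularizedDet_of_closure_eq_top (n := 2) (by norm_num)
      (x := ![x, y]) (by simpa [Matrix.range_cons, Set.pair_comm] using hxy)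
      (ζ := fun _ => 1) (by simp)
    have hA : ContinuousLinearMap.id ℂ _ +
        ∑ i, (fun _ => (1 : ℂ)) i • FugledeKadison.R ((![x, y] : Fin 2 → FreeGroup (Fin 2)) i) =
          ContinuousLinearMap.id ℂ _ + FugledeKadison.R x + FugledeKadison.R y := by
      simp [Fin.sum_univ_two, add_assoc]
    have hval : ((2 : ℕ) : ℝ) ^ (((2 : ℕ) : ℝ) / 2) /
        (((2 : ℕ) : ℝ) + 1) ^ ((((2 : ℕ) : ℝ) - 1) / 2) = 2 / √3 := by
      rw [Real.sqrt_eq_rpow]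
      norm_num
    rw [hA, hval] at h
    exact ⟨h, h.limUnder_eq⟩
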